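/- Let $n\ge 1$, $q\ge 2$, let $M,K\in\mathbb{R}^{n\times n}$ be symmetric positive definite, and for $i,j\in\{1,\dots,q\}$ let $D_{ij},R_{ij}\in\mathbb{R}^{n\times n}$ be symmetric positive semidefinite with $D_{ij}=D_{ji}$, $R_{ij}=R_{ji}$ and $D_{ii}=R_{ii}=0$. Suppose that the roots $\sigma_1,\dots,\sigma_n$ of $s\mapsto\det(sM-K)$, which are the eigenvalues of $P:=M^{-1/2}KM^{-1/2}$, are pairwise distinct; let $v_1,\dots,v_n\in\mathbb{R}^n$ be unit vectors with $Pv_k=\sigma_kv_k$, and put $V=[v_1\ \cdots\ v_n]$, $\Lambda=\mathrm{diag}(\sigma_1,\dots,\sigma_n)$. For a family of weights $(W_{ij})_{i,j=1}^q$ let $\mathrm{lap}(W_{ij})$ be the block matrix with diagonal blocks $\sum_l W_{il}$ and off-diagonal blocks $-W_{ij}$. Put $L_{\rm d}=\mathrm{lap}(M^{-1/2}D_{ij}M^{-1/2})$, $L_{\rm r}=\mathrm{lap}(M^{-1/2}R_{ij}M^{-1/2})$, and let $G$ and $B$ be the $qn\times qn$ block matrices whose $q\times q$ blocks, for $k,\ell=1,\dots,n$,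 are $$G_{k\ell}=[I_q\otimes v_k^T]L_{\rm d}[I_q\otimes v_\ell],\qquad B_{k\ell}=[I_q\otimes v_k^T]L_{\rm r}[I_q\otimes v_\ell].$$ For $\varepsilon\ge 0$ and $j=\sqrt{-1}$ put $$\Gamma_\varepsilon=L_{\rm d}+j\bigl([I_q\otimes P]+\varepsilon L_{\rm r}\bigr),\qquad \Omega_\varepsilon=G+j\bigl([\Lambda\otimes I_q]+\varepsilon B\bigr).$$ Let $\Pi$ be the permutation matrix with $\Pi^T[X\otimes Y]\Pi=Y\otimes X$ for all $X\in\mathbb{R}^{q\times q}$, $Y\in\mathbb{R}^{n\times n}$. Then $[I_q\otimes V]\Pi$ is orthogonal and $\Omega_\varepsilon=\Pi^T[I_q\otimes V^T]\,\Gamma_\varepsilon\,[I_q\otimes V]\Pi$. Moreover, for every $\varepsilon\ge 0$, the array $$M\ddot x_i+Kx_i+\sum_{j=1}^qD_{ij}(\dot x_i-\dot x_j)+\varepsilon\sum_{j=1}^qR_{ij}(x_i-x_j)=0,\qquad i=1,\dots,q,$$ synchronizes, i.e. every solution satisfies $\|x_i(t)-x_j(t)\|\to0$ as $t\to\infty$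 for all $i,j$, if and only if $\mathrm{Re}\,\lambda_{n+1}(\Omega_\varepsilon)>0$, where $\lambda_1(X),\lambda_2(X),\dots$ denote the eigenvalues of a complex square matrix $X$, repeated according to algebraic multiplicity and ordered so that $\mathrm{Re}\,\lambda_1(X)\le\mathrm{Re}\,\lambda_2(X)\le\cdots$. -/

import Mathlib

open scoped Matrix Kronecker

namespace CoupledOsc

/-- Admissible families of coupling matrices: `W i j` is symmetric positive semidefinite,
`W i j = W j i` and `W i i = 0`. (Over the reals, `Matrix.PosSemidef` includes symmetry.) -/
structure IsCoupling {q n : ℕ} (W : Fin q → Fin q → Matrix (Fin n) (Fin n) ℝ) : Prop where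
  posSemidef : ∀ i j, (W i j).PosSemidef
  symm : ∀ i j, W i j = W j i
  diag : ∀ i, W i i = 0

/-- `x : ℝ → (ℝⁿ)^q` is a solution of
`M xᵢ'' + K xᵢ + ∑ⱼ Dᵢⱼ (xᵢ' - xⱼ') + ε ∑ⱼ Rᵢⱼ (xᵢ - xⱼ) = 0`, `i = 1, …, q`;
here `v i = xᵢ'` and `a i = xᵢ''`. -/
def IsSolution {q n : ℕ} (M K : Matrix (Fin n) (Fin n) ℝ)
    (D R : Fin q → Fin q → Matrix (Fin n) (Fin n) ℝ) (ε : ℝ)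
    (x : Fin q → ℝ → (Fin n → ℝ)) : Prop :=
  ∃ v a : Fin q → ℝ → (Fin n → ℝ),
    (∀ i t, HasDerivAt (x i) (v i t) t) ∧
    (∀ i t, HasDerivAt (v i) (a i t) t) ∧
    ∀ i t, M *ᵥ a i t + K *ᵥ x i t + ∑ j, D i j *ᵥ (v i t - v j t)
      + ε • ∑ j, R i j *ᵥ (x i t - x j t) = 0

/-- The array synchronizes: along every solution, `‖xᵢ(t) - xⱼ(t)‖ → 0` (Euclidean norm)
as `t → ∞`, for all `i, j`. -/
def Synchronizes {q n : ℕ} (M K : Matrix (Fin n) (Fin n) ℝ)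
    (D R : Fin q → Fin q → Matrix (Fin n) (Fin n) ℝ) (ε : ℝ) : Prop :=
  ∀ x : Fin q → ℝ → (Fin n → ℝ), IsSolution M K D R ε x →
    ∀ i j, Filter.Tendsto (fun t => ‖WithLp.toLp 2 (x i t - x j t)‖) Filter.atTop (nhds 0)

open scoped MatrixOrder in
/-- `M^{-1/2}`, the inverse of the positive semidefinite square root of `M`. -/
noncomputable def invSqrt {n : ℕ} (M : Matrix (Fin n) (Fin n) ℝ) : Matrix (Fin n) (Fin n) ℝ :=
  (CFC.sqrt M)⁻¹

/-- `P = M^{-1/2} K M^{-1/2}`. -/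
noncomputable def oscP {n : ℕ} (M K : Matrix (Fin n) (Fin n) ℝ) : Matrix (Fin n) (Fin n) ℝ :=
  invSqrt M * K * invSqrt M

/-- The matrix-weighted Laplacian `lap (Wᵢⱼ)`: diagonal blocks `∑ₗ Wᵢₗ`, off-diagonal blocks
`-Wᵢⱼ`. The entry `((i, a), (j, b))` is the entry `(a, b)` of the block `(i, j)`. -/
def lap {q n : ℕ} (W : Fin q → Fin q → Matrix (Fin n) (Fin n) ℝ) :
    Matrix (Fin q × Fin n) (Fin q × Fin n) ℝ :=
  Matrix.of fun r c => if r.1 = c.1 then (∑ l, W r.1 l) r.2 c.2 else -W r.1 c.1 r.2 c.2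

/-- `lap (M^{-1/2} Wᵢⱼ M^{-1/2})`: this is `L_d` for `W = D` and `L_r` for `W = R`. -/
noncomputable def couplingLap {q n : ℕ} (M : Matrix (Fin n) (Fin n) ℝ)
    (W : Fin q → Fin q → Matrix (Fin n) (Fin n) ℝ) :
    Matrix (Fin q × Fin n) (Fin q × Fin n) ℝ :=
  lap fun i j => invSqrt M * W i j * invSqrt M

/-- The `q × q` block `[I_q ⊗ v_kᵀ] L [I_q ⊗ v_ℓ]`. -/
def modalBlock {q n : ℕ} (v : Fin n → Fin n → ℝ)
    (L : Matrix (Fin q × Fin n) (Fin q × Fin n) ℝ) (k l : Fin n) :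
    Matrix (Fin q) (Fin q) ℝ :=
  (((1 : Matrix (Fin q) (Fin q) ℝ) ⊗ₖ Matrix.replicateRow Unit (v k)) * L *
    ((1 : Matrix (Fin q) (Fin q) ℝ) ⊗ₖ Matrix.replicateCol Unit (v l))).submatrix
      (fun i => (i, ())) (fun i => (i, ()))

/-- The `n × n` block matrix with blocks `[I_q ⊗ v_kᵀ] L [I_q ⊗ v_ℓ]`:
this is `G` for `L = L_d` and `B` for `L = L_r`. -/
def modalMatrix {q n : ℕ} (v : Fin n → Fin n → ℝ)
    (L : Matrix (Fin q × Fin n) (Fin q × Fin n) ℝ) :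
    Matrix (Fin n × Fin q) (Fin n × Fin q) ℝ :=
  Matrix.of fun r c => modalBlock v L r.1 c.1 r.2 c.2

/-- `X + jY` for real matrices `X`, `Y`. -/
noncomputable def toComplex {ι : Type*} (X Y : Matrix ι ι ℝ) : Matrix ι ι ℂ :=
  X.map Complex.ofReal + Complex.I • Y.map Complex.ofReal

/-- `Γ_ε = L_d + j([I_q ⊗ P] + ε L_r)`. -/
noncomputable def Gam {q n : ℕ} (M K : Matrix (Fin n) (Fin n) ℝ)
    (D R : Fin q → Fin q → Matrix (Fin n) (Fin n) ℝ) (ε : ℝ) :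
    Matrix (Fin q × Fin n) (Fin q × Fin n) ℂ :=
  toComplex (couplingLap M D)
    ((1 : Matrix (Fin q) (Fin q) ℝ) ⊗ₖ oscP M K + ε • couplingLap M R)

/-- `Ω_ε = G + j([Λ ⊗ I_q] + ε B)`, with `Λ = diag(σ₁, …, σₙ)`. -/
noncomputable def Omg {q n : ℕ} (M : Matrix (Fin n) (Fin n) ℝ)
    (D R : Fin q → Fin q → Matrix (Fin n) (Fin n) ℝ) (ε : ℝ)
    (σ : Fin n → ℝ) (v : Fin n → Fin n → ℝ) :
    Matrix (Fin n × Fin q) (Fin n × Fin q) ℂ :=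
  toComplex (modalMatrix v (couplingLap M D))
    (Matrix.diagonal σ ⊗ₖ (1 : Matrix (Fin q) (Fin q) ℝ) + ε • modalMatrix v (couplingLap M R))

/-- The permutation matrix `Π` that exchanges the two Kronecker factors. -/
def swapMat (q n : ℕ) : Matrix (Fin q × Fin n) (Fin n × Fin q) ℝ :=
  (1 : Matrix (Fin q × Fin n) (Fin q × Fin n) ℝ).submatrix id Prod.swap

theorem swapMat_transpose_mul_kronecker_mul {q n : ℕ} (X : Matrix (Fin q) (Fin q) ℝ)
    (Y : Matrix (Fin n) (Fin n) ℝ) :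
    (swapMat q n)ᵀ * (X ⊗ₖ Y) * swapMat q n = Y ⊗ₖ X := by
  ext ⟨a, i⟩ ⟨b, j⟩
  simp [swapMat, Matrix.mul_apply, Matrix.one_apply, mul_comm]

/-- `[I_q ⊗ V] Π` with `V = [v₁ v₂ ⋯ vₙ]` (the `v_k` are the columns). -/
def simMat {n : ℕ} (q : ℕ) (v : Fin n → Fin n → ℝ) :
    Matrix (Fin q × Fin n) (Fin n × Fin q) ℝ :=
  ((1 : Matrix (Fin q) (Fin q) ℝ) ⊗ₖ (Matrix.of v)ᵀ) * swapMat q n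

/-- `Re λ_k(X)` for `k = 1, 2, …, card ι`: the `k`th smallest among the real parts of the
eigenvalues of `X`, the eigenvalues being counted with algebraic multiplicity.
(The value for other `k` is irrelevant.) -/
noncomputable def reLambda {ι : Type*} [Fintype ι] [DecidableEq ι] (k : ℕ) (X : Matrix ι ι ℂ) :
    ℝ :=
  ((X.charpoly.roots.map Complex.re).sort (· ≤ ·)).getD (k - 1) 0

end CoupledOsc

open CoupledOsc

/-!
The columns of `[I_q ⊗ V]Π` are orthonormal because the `v_k` are eigenvectors of the symmetric
matrix `P` for distinct eigenvalues, so `Ω_ε` and `Γ_ε` are similar and have the same spectrum.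

Substituting `x_i = M^{-1/2} z_i` turns the array into `z'' + L_d z' + A z = 0` with
`A = [I_q ⊗ P] + ε L_r` positive definite and `L_d` positive semidefinite, while
`Γ_ε = L_d + jA`. Taking the quadratic form of an eigenvector shows that the eigenvalues of `Γ_ε`
with nonpositive real part are purely imaginary, and that their eigenvectors are exactly the
undamped modes: the eigenvectors of `A` in the kernel of `L_d`. These eigenvalues are semisimple,
so their number, with algebraic multiplicity, is the dimension of the span of the undamped modes.
This span always contains the `n`-dimensional space of synchronous states, hence
`Re λ_{n+1}(Γ_ε) > 0` says that every undamped mode is synchronous.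

An undamped mode oscillates forever, so synchronization forces all of them to be synchronous.
Conversely, let `J` be the orthogonal projection onto the synchronous states. It commutes with `A`
and annihilates `L_d`, so `(1 - J)z` solves the equation with damping `L_d + J`. If every
undamped mode of the original equation is synchronous, the new one has none, and then all its
solutions decay.
-/

namespace CoupledOsc

open Filter Topology
open scoped ComplexOrder

section LinearODE

theorem norm_le_of_hasDerivAt_smul_add {E : Type*} [NormedAddCommGroup E] [NormedSpace ℂ E]
    {y g : ℝ → E} {μ : ℂ} (hμ : μ.re < 0) (hy : ∀ t, HasDerivAt y (μ • y t + g t) t)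
    {c T : ℝ} (hg : ∀ t ≥ T, ‖g t‖ ≤ c) {t : ℝ} (ht : T ≤ t) :
    ‖y t‖ ≤ Real.exp (μ.re * (t - T)) * ‖y T‖ + c / -μ.re := by
  have hB (s : ℝ) : HasDerivAt
      (fun s => Real.exp (-(μ.re * (s - T))) * (c / -μ.re) + (‖y T‖ - c / -μ.re))
      (Real.exp (-(μ.re * (s - T))) * c) s := by
    refine ((((((hasDerivAt_id' s).sub_const T).const_mul μ.re).fun_neg.exp).mul_const
      (c / -μ.re)).add_const (‖y T‖ - c / -μ.re)).congr_deriv ?_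
    field [hμ.ne]
  have hu (s : ℝ) : HasDerivAt (fun s : ℝ => Complex.exp (-(μ * (s - T))) • y s)
      (Complex.exp (-(μ * (s - T))) • g s) s := by
    refine (((((hasDerivAt_id' s).ofReal_comp.sub_const (T : ℂ)).const_mul μ).fun_neg.cexp).fun_smul
      (hy s)).congr_deriv ?_
    module
  have hexp (s : ℝ) : ‖Complex.exp (-(μ * (s - T)))‖ = Real.exp (-(μ.re * (s - T))) := by
    simp [Complex.norm_exp]
  have hc : 0 ≤ c := (norm_nonneg _).trans (hg T le_rfl)
  have bound := image_norm_le_of_norm_deriv_right_le_deriv_boundary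
    (fun s _ => (hu s).continuousAt.continuousWithinAt) (fun s _ => (hu s).hasDerivWithinAt)
    (by simp) hB
    (fun s hs => by rw [norm_smul, hexp]; gcongr; exact hg s hs.1) (Set.right_mem_Icc.2 ht)
  rw [norm_smul, hexp, Real.exp_neg, inv_mul_le_iff₀ (Real.exp_pos _)] at bound
  have hdiv : 0 ≤ c / -μ.re := div_nonneg hc (neg_nonneg.2 hμ.le)
  calc ‖y t‖ ≤ _ := bound
    _ = Real.exp (μ.re * (t - T)) * ‖y T‖ + (c / -μ.re)
        - Real.exp (μ.re * (t - T)) * (c / -μ.re) := by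
      field_simp [hμ.ne]
      ring
    _ ≤ _ := sub_le_self _ (by positivity)

theorem tendsto_zero_of_hasDerivAt_smul_add {E : Type*} [NormedAddCommGroup E] [NormedSpace ℂ E]
    {y g : ℝ → E} {μ : ℂ} (hμ : μ.re < 0) (hy : ∀ t, HasDerivAt y (μ • y t + g t) t)
    (hg : Tendsto g atTop (𝓝 0)) : Tendsto y atTop (𝓝 0) := by
  rw [NormedAddGroup.tendsto_nhds_zero] at hg ⊢
  intro δ hδ
  obtain ⟨T, hT⟩ := eventually_atTop.1 (hg (-μ.re * (δ / 2)) (mul_pos (neg_pos.2 hμ) (half_pos hδ)))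
  have decay : Tendsto (fun t => Real.exp (μ.re * (t - T)) * ‖y T‖) atTop (𝓝 0) := by
    have := Real.tendsto_exp_atBot.comp
      ((tendsto_atTop_add_const_right atTop (-T) tendsto_id).const_mul_atTop_of_neg hμ)
    simpa [sub_eq_add_neg] using this.mul_const ‖y T‖
  filter_upwards [eventually_ge_atTop T, decay.eventually_lt_const (half_pos hδ)] with t ht hdecay
  have bound := norm_le_of_hasDerivAt_smul_add hμ hy (fun s hs => (hT s hs).le) ht
  rw [mul_div_cancel_left₀ _ (neg_pos.2 hμ).ne'] at bound
  linarith

theorem hasDerivAt_linearMap_comp {E F : Type*} [NormedAddCommGroup E] [NormedSpace ℝ E]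
    [FiniteDimensional ℝ E] [NormedAddCommGroup F] [NormedSpace ℝ F] (L : E →ₗ[ℝ] F)
    {x : ℝ → E} {x' : E} {t : ℝ} (h : HasDerivAt x x' t) :
    HasDerivAt (fun s => L (x s)) (L x') t :=
  (LinearMap.toContinuousLinearMap L).hasFDerivAt.comp_hasDerivAt t h

variable {E : Type*} [NormedAddCommGroup E] [NormedSpace ℂ E] [FiniteDimensional ℂ E]
  {F : Module.End ℂ E} {x : ℝ → E}

open Polynomial in
theorem tendsto_zero_of_aeval_prod_tendsto_zero (hx : ∀ t, HasDerivAt x (F (x t)) t)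
    {s : Multiset ℂ} (hs : ∀ μ ∈ s, μ.re < 0)
    (h : Tendsto (fun t => aeval F (s.map (X - C ·)).prod (x t)) atTop (𝓝 0)) :
    Tendsto x atTop (𝓝 0) := by
  induction s using Multiset.induction_on with
  | empty => simpa using h
  | cons μ s ih =>
    refine ih (fun ν hν => hs ν (Multiset.mem_cons_of_mem hν)) ?_
    set p := (s.map (X - C ·)).prod
    refine tendsto_zero_of_hasDerivAt_smul_add (hs μ (Multiset.mem_cons_self μ s))
      (g := fun t => aeval F ((X - C μ) * p) (x t)) (fun t => ?_) (by simpa using h)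
    have hderiv : aeval F p (F (x t)) = μ • aeval F p (x t) + aeval F ((X - C μ) * p) (x t) := by
      have : aeval F (p * X) = aeval F (C μ * p + (X - C μ) * p) := by congr 1; ring
      simpa using congrArg (· (x t)) this
    rw [← hderiv]
    exact hasDerivAt_linearMap_comp ((aeval F p).restrictScalars ℝ) (hx t)

theorem tendsto_zero_of_hasEigenvalue_re_neg (hF : ∀ μ, F.HasEigenvalue μ → μ.re < 0)
    (hx : ∀ t, HasDerivAt x (F (x t)) t) : Tendsto x atTop (𝓝 0) := by
  have hF0 : F.charpoly ≠ 0 := F.charpoly_monic.ne_zero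
  refine tendsto_zero_of_aeval_prod_tendsto_zero hx (s := F.charpoly.roots) (fun μ hμ =>
    hF μ ((F.hasEigenvalue_iff_isRoot_charpoly μ).2 ((Polynomial.mem_roots hF0).1 hμ))) ?_
  rw [← (IsAlgClosed.splits F.charpoly).eq_prod_roots_of_monic F.charpoly_monic,
    F.aeval_self_charpoly]
  exact tendsto_const_nhds

end LinearODE

section EigenvalueCount

theorem lt_getElem_iff_countP_le {l : List ℝ} (hl : l.SortedLE) {m : ℕ} (hm : m < l.length)
    (c : ℝ) : c < l[m] ↔ l.countP (· ≤ c) ≤ m := by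
  induction l generalizing m with
  | nil => simp at hm
  | cons x l ih =>
    obtain ⟨hx, hl⟩ := List.pairwise_cons.1 hl.pairwise
    by_cases hxc : x ≤ c
    · cases m with
      | zero => simp [hxc]
      | succ m => simp [hxc, ih hl.sortedLE]
    · have hlc : l.countP (· ≤ c) = 0 :=
        List.countP_eq_zero.2 fun y hy => by simpa using (not_le.1 hxc).trans_le (hx y hy)
      have : c < (x :: l)[m] := by
        cases m with
        | zero => simpa using hxc
        | succ m => exact (not_le.1 hxc).trans_le (hx _ (List.getElem_mem _))
      simp [hxc, hlc, this]

theorem zero_lt_reLambda_succ_iff {ι : Type*} [Fintype ι] [DecidableEq ι] (X : Matrix ι ι ℂ)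
    {m : ℕ} (hm : m < Fintype.card ι) :
    0 < reLambda (m + 1) X ↔ X.charpoly.roots.countP (fun μ => μ.re ≤ 0) ≤ m := by
  set l := (X.charpoly.roots.map Complex.re).sort (· ≤ ·) with hl
  have hlen : l.length = Fintype.card ι := by
    rw [hl, Multiset.length_sort, Multiset.card_map,
      ← (IsAlgClosed.splits X.charpoly).natDegree_eq_card_roots, X.charpoly_natDegree_eq_dim]
  have hm' : m < l.length := by rwa [hlen]
  rw [reLambda, Nat.add_sub_cancel, ← hl, List.getD_eq_getElem _ _ hm',
    lt_getElem_iff_countP_le (Multiset.pairwise_sort _ _).sortedLE hm', ← Multiset.coe_countP,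
    Multiset.sort_eq, Multiset.countP_map, Multiset.countP_eq_card_filter]

variable {𝕜 V κ : Type*} [Field 𝕜] [AddCommGroup V] [Module 𝕜 V] [FiniteDimensional 𝕜 V]

theorem finrank_biSup_finset_of_iSupIndep {N : κ → Submodule 𝕜 V} (hN : iSupIndep N)
    (s : Finset κ) :
    Module.finrank 𝕜 (⨆ i ∈ s, N i : Submodule 𝕜 V) = ∑ i ∈ s, Module.finrank 𝕜 (N i) := by
  classical
  induction s using Finset.induction_on with
  | empty => simp
  | insert i s hi ih =>
    have hdisj : Disjoint (N i) (⨆ j ∈ s, N j) := by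
      simpa using hN.disjoint_biSup (x := i) (y := (s : Set κ)) (by simpa using hi)
    have hsup := Submodule.finrank_sup_add_finrank_inf_eq (N i) (⨆ j ∈ s, N j)
    rw [hdisj.eq_bot, finrank_bot, add_zero] at hsup
    rw [Finset.iSup_insert, hsup, ih, Finset.sum_insert hi]

theorem countP_roots_charpoly_eq_finrank (f : Module.End 𝕜 V) (p : 𝕜 → Prop) [DecidablePred p] :
    f.charpoly.roots.countP p =
      Module.finrank 𝕜 (⨆ (μ) (_ : p μ), f.maxGenEigenspace μ : Submodule 𝕜 V) := by
  classical
  have hbot (μ : 𝕜) (hμ : μ ∉ f.charpoly.roots) : f.maxGenEigenspace μ = ⊥ := by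
    rwa [← Submodule.finrank_eq_zero, LinearMap.finrank_maxGenEigenspace_eq,
      ← Polynomial.count_roots, Multiset.count_eq_zero]
  have hsup : (⨆ (μ) (_ : p μ), f.maxGenEigenspace μ) =
      ⨆ μ ∈ f.charpoly.roots.toFinset.filter p, f.maxGenEigenspace μ := by
    refine le_antisymm (iSup₂_le fun μ hμ => ?_) (iSup₂_le fun μ hμ =>
      le_iSup₂_of_le μ (Finset.mem_filter.1 hμ).2 le_rfl)
    by_cases h : μ ∈ f.charpoly.roots
    · exact le_iSup₂_of_le μ (by simpa [hμ] using h) le_rfl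
    · rw [hbot μ h]; exact bot_le
  rw [hsup, finrank_biSup_finset_of_iSupIndep f.independent_maxGenEigenspace,
    Multiset.countP_eq_card_filter, ← Multiset.toFinset_sum_count_eq, Multiset.toFinset_filter]
  refine Finset.sum_congr rfl fun μ hμ => ?_
  rw [LinearMap.finrank_maxGenEigenspace_eq,
    Multiset.count_filter_of_pos (Finset.mem_filter.1 hμ).2, Polynomial.count_roots]

end EigenvalueCount

theorem maxGenEigenspace_eq_eigenspace_of_ker_sq_le {R M : Type*} [CommRing R] [AddCommGroup M]
    [Module R M] {f : Module.End R M} {μ : R}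
    (h : LinearMap.ker ((f - μ • 1) ^ 2) ≤ LinearMap.ker (f - μ • 1)) :
    f.maxGenEigenspace μ = f.eigenspace μ := by
  refine le_antisymm (fun w hw => ?_) Module.End.eigenspace_le_maxGenEigenspace
  obtain ⟨k, hk⟩ := (f.mem_maxGenEigenspace μ w).1 hw
  have key (k : ℕ) : ((f - μ • 1) ^ (k + 1)) w = 0 → (f - μ • 1) w = 0 := by
    induction k with
    | zero => simp
    | succ k ih =>
      intro hk
      refine ih ?_
      rw [pow_succ', Module.End.mul_apply]
      refine h ?_
      rwa [LinearMap.mem_ker, ← Module.End.mul_apply, ← pow_add, add_comm 2 k]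
  have := key k (by rw [pow_succ', Module.End.mul_apply, hk, map_zero])
  simpa [Module.End.mem_eigenspace_iff, sub_eq_zero] using this

section Dissipative

variable {ι : Type*} [Fintype ι] {A B : Matrix ι ι ℂ}

/-- The span of the undamped modes of `z'' + B z' + A z = 0`: the eigenvectors of `A` for real
eigenvalues that lie in the kernel of `B`. -/
def undampedSpace (A B : Matrix ι ι ℂ) : Submodule ℂ (ι → ℂ) :=
  ⨆ c : ℝ, LinearMap.ker B.mulVecLin ⊓ Module.End.eigenspace A.mulVecLin c

theorem undampedSpace_le_iff {S : Submodule ℂ (ι → ℂ)} :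
    undampedSpace A B ≤ S ↔
      ∀ (w : ι → ℂ) (c : ℝ), B *ᵥ w = 0 → A *ᵥ w = (c : ℂ) • w → w ∈ S := by
  rw [undampedSpace, iSup_le_iff]
  simp only [SetLike.le_def, Submodule.mem_inf, LinearMap.mem_ker,
    Module.End.mem_eigenspace_iff, Matrix.mulVecLin_apply, and_imp]
  exact forall_comm

theorem mem_undampedSpace {w : ι → ℂ} {c : ℝ} (hBw : B *ᵥ w = 0) (hAw : A *ᵥ w = (c : ℂ) • w) :
    w ∈ undampedSpace A B :=
  undampedSpace_le_iff.1 le_rfl w c hBw hAw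

theorem mulVec_eq_of_eigenvector_re_nonpos (hA : A.IsHermitian) (hB : B.PosSemidef) {μ : ℂ}
    (hμ : μ.re ≤ 0) {w : ι → ℂ} (hw : (B + Complex.I • A) *ᵥ w = μ • w) :
    B *ᵥ w = 0 ∧ A *ᵥ w = (μ.im : ℂ) • w := by
  obtain ⟨b, hb, hb'⟩ := RCLike.nonneg_iff_exists_ofReal.1 (hB.dotProduct_mulVec_nonneg w)
  obtain ⟨c, hc, hc'⟩ := RCLike.nonneg_iff_exists_ofReal.1 (dotProduct_star_self_nonneg w)
  have energy : b = μ.re * c := by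
    have := congrArg (fun u => (star w ⬝ᵥ u).re) hw
    have him : (star w ⬝ᵥ A *ᵥ w).im = 0 := hA.im_star_dotProduct_mulVec_self w
    simpa [Matrix.add_mulVec, Matrix.smul_mulVec, him, ← hb', ← hc'] using this
  have hb0 : b = 0 := le_antisymm (energy ▸ mul_nonpos_of_nonpos_of_nonneg hμ hc) hb
  have hBw : B *ᵥ w = 0 := (hB.dotProduct_mulVec_zero_iff w).1 (by simp [← hb', hb0])
  refine ⟨hBw, ?_⟩
  rcases eq_or_ne w 0 with rfl | hw0
  · simp
  have hc0 : c ≠ 0 := by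
    rintro rfl
    exact hw0 (dotProduct_star_self_eq_zero.1 (by simp [← hc']))
  have hre : μ.re = 0 := by simpa [hb0, hc0] using energy
  have hμ : μ = Complex.I * μ.im := by apply Complex.ext <;> simp [hre]
  rw [Matrix.add_mulVec, hBw, zero_add, Matrix.smul_mulVec, hμ, mul_smul] at hw
  simpa using congrArg (-Complex.I • ·) hw

theorem maxGenEigenspace_eq_eigenspace_of_re_nonpos (hA : A.IsHermitian) (hB : B.PosSemidef)
    {μ : ℂ} (hμ : μ.re ≤ 0) :
    Module.End.maxGenEigenspace (B + Complex.I • A).mulVecLin μ =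
      Module.End.eigenspace (B + Complex.I • A).mulVecLin μ := by
  classical
  set N : Matrix ι ι ℂ := B + Complex.I • A - μ • 1 with hN
  have hlin : (B + Complex.I • A).mulVecLin - μ • 1 = N.mulVecLin := by
    refine LinearMap.ext fun w => ?_
    simp [hN]
  -- `ker N ≤ ker Nᴴ` makes `N` range-symmetric, so `N (N w) = 0` gives `NᴴN w = 0`.
  have hadj (u : ι → ℂ) (hu : N *ᵥ u = 0) : Nᴴ *ᵥ u = 0 := by
    obtain ⟨hBu, hAu⟩ := mulVec_eq_of_eigenvector_re_nonpos hA hB hμ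
      (by simpa [hN, Matrix.sub_mulVec, Matrix.smul_mulVec, sub_eq_zero] using hu)
    have hscalar : Complex.I * μ.im - μ = -(Complex.I * μ.im) - star μ := by
      apply Complex.ext <;> simp
    calc Nᴴ *ᵥ u = (-(Complex.I * μ.im) - star μ) • u := by
          simp [hN, Matrix.sub_mulVec, Matrix.add_mulVec, Matrix.smul_mulVec, Matrix.neg_mulVec,
            hA.eq, hB.isHermitian.eq, hBu, hAu, sub_smul, mul_smul]
      _ = N *ᵥ u := by
          rw [← hscalar]
          simp [hN, Matrix.sub_mulVec, Matrix.add_mulVec, Matrix.smul_mulVec, hBu, hAu, sub_smul,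
            mul_smul]
      _ = 0 := hu
  refine maxGenEigenspace_eq_eigenspace_of_ker_sq_le ?_
  rw [hlin]
  intro w hw
  rw [LinearMap.mem_ker, pow_two, Module.End.mul_apply] at hw
  exact (Matrix.conjTranspose_mul_self_mulVec_eq_zero N w).1
    (by rw [← Matrix.mulVec_mulVec]; exact hadj _ hw)

variable [DecidableEq ι]

theorem finrank_undampedSpace (hA : A.IsHermitian) (hB : B.PosSemidef) :
    Module.finrank ℂ (undampedSpace A B) =
      (B + Complex.I • A).charpoly.roots.countP (fun μ => μ.re ≤ 0) := by
  have hsup : undampedSpace A B = ⨆ (μ : ℂ) (_ : μ.re ≤ 0),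
      Module.End.maxGenEigenspace (B + Complex.I • A).mulVecLin μ := by
    refine le_antisymm (undampedSpace_le_iff.2 fun w c hBw hAw => ?_) (iSup₂_le fun μ hμ w hw => ?_)
    · refine Submodule.mem_iSup_of_mem (Complex.I * c) (Submodule.mem_iSup_of_mem (by simp) ?_)
      refine Module.End.eigenspace_le_maxGenEigenspace (Module.End.mem_eigenspace_iff.2 ?_)
      simp [hBw, hAw, mul_smul]
    · rw [maxGenEigenspace_eq_eigenspace_of_re_nonpos hA hB hμ,
        Module.End.mem_eigenspace_iff] at hw
      obtain ⟨hBw, hAw⟩ := mulVec_eq_of_eigenvector_re_nonpos hA hB hμ hw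
      exact mem_undampedSpace hBw hAw
  rw [← Matrix.charpoly_mulVecLin, countP_roots_charpoly_eq_finrank, hsup]

theorem zero_lt_reLambda_iff_undampedSpace_le (hA : A.IsHermitian) (hB : B.PosSemidef)
    {S : Submodule ℂ (ι → ℂ)} (hS : S ≤ undampedSpace A B)
    (hcard : Module.finrank ℂ S < Fintype.card ι) :
    0 < reLambda (Module.finrank ℂ S + 1) (B + Complex.I • A) ↔ undampedSpace A B ≤ S := by
  rw [zero_lt_reLambda_succ_iff _ hcard, ← finrank_undampedSpace hA hB]
  exact ⟨fun h => (Submodule.eq_of_le_of_finrank_le hS h).ge, Submodule.finrank_mono⟩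

end Dissipative

section DampedMotion

/-- `z` is a solution of `z'' + B z' + A z = 0`; here `v = z'` and `a = z''`. -/
def IsDampedMotion {𝕜 ι : Type*} [RCLike 𝕜] [Fintype ι] (A B : Matrix ι ι 𝕜) (z : ℝ → ι → 𝕜) :
    Prop :=
  ∃ v a : ℝ → ι → 𝕜, (∀ t, HasDerivAt z (v t) t) ∧ (∀ t, HasDerivAt v (a t) t) ∧
    ∀ t, a t + B *ᵥ v t + A *ᵥ z t = 0

theorem IsDampedMotion.map {𝕜 𝕜' ι κ : Type*} [RCLike 𝕜] [RCLike 𝕜'] [Fintype ι] [Fintype κ]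
    {A B : Matrix ι ι 𝕜} {A' B' : Matrix κ κ 𝕜'} {z : ℝ → ι → 𝕜} (hz : IsDampedMotion A B z)
    (T : (ι → 𝕜) →ₗ[ℝ] (κ → 𝕜')) (hA : ∀ w, T (A *ᵥ w) = A' *ᵥ T w)
    (hB : ∀ w, T (B *ᵥ w) = B' *ᵥ T w) : IsDampedMotion A' B' fun t => T (z t) := by
  obtain ⟨v, a, hv, ha, hz⟩ := hz
  refine ⟨fun t => T (v t), fun t => T (a t), fun t => hasDerivAt_linearMap_comp T (hv t),
    fun t => hasDerivAt_linearMap_comp T (ha t), fun t => ?_⟩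
  rw [← hA, ← hB, ← map_add, ← map_add, hz, map_zero]

theorem re_eq_zero_of_quadratic_root {a b c : ℝ} (ha : 0 < a) (hb : 0 ≤ b) (hc : 0 < c) {s : ℂ}
    (hs : 0 ≤ s.re) (h : c * s ^ 2 + b * s + a = 0) : s.re = 0 ∧ b = 0 := by
  have hre : c * (s.re ^ 2 - s.im ^ 2) + b * s.re + a = 0 := by
    simpa [pow_two] using congrArg Complex.re h
  have him : s.im * (2 * (c * s.re) + b) = 0 := by
    have := congrArg Complex.im h
    simp only [pow_two, Complex.add_im, Complex.mul_im, Complex.ofReal_re, Complex.ofReal_im,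
      Complex.zero_im] at this
    linarith
  have hcs : 0 ≤ c * s.re := by positivity
  rcases mul_eq_zero.1 him with him | hsum
  · have : 0 ≤ c * s.re ^ 2 := by positivity
    have : 0 ≤ b * s.re := by positivity
    simp only [him] at hre
    linarith
  · have : c * s.re = 0 := by linarith
    exact ⟨by simpa [hc.ne'] using this, by linarith⟩

variable {ι : Type*} [Fintype ι] {A B : Matrix ι ι ℂ}

theorem re_neg_of_undampedSpace_eq_bot (hA : A.PosDef) (hB : B.PosSemidef)
    (hAB : undampedSpace A B = ⊥) {s : ℂ} {w : ι → ℂ} (hw : w ≠ 0)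
    (h : s ^ 2 • w + s • B *ᵥ w + A *ᵥ w = 0) : s.re < 0 := by
  obtain ⟨a, ha, ha'⟩ := RCLike.pos_iff_exists_ofReal.1 (hA.dotProduct_mulVec_pos hw)
  obtain ⟨b, hb, hb'⟩ := RCLike.nonneg_iff_exists_ofReal.1 (hB.dotProduct_mulVec_nonneg w)
  obtain ⟨c, hc, hc'⟩ :=
    RCLike.pos_iff_exists_ofReal.1 (Matrix.dotProduct_star_self_pos_iff.2 hw)
  by_contra! hs
  have hquad : c * s ^ 2 + b * s + a = 0 := by
    simpa [← ha', ← hb', ← hc', mul_comm] using congrArg (star w ⬝ᵥ ·) h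
  obtain ⟨hre, hb0⟩ := re_eq_zero_of_quadratic_root ha hb hc hs hquad
  have hBw : B *ᵥ w = 0 := (hB.dotProduct_mulVec_zero_iff w).1 (by simp [← hb', hb0])
  have hAw : A *ᵥ w = ((s.im ^ 2 : ℝ) : ℂ) • w := by
    have hs2 : s ^ 2 = -((s.im ^ 2 : ℝ) : ℂ) := by
      apply Complex.ext <;> simp [pow_two, hre]
    rw [hBw, smul_zero, add_zero, hs2, neg_smul] at h
    exact (neg_add_eq_zero.1 h).symm
  exact hw ((Submodule.mem_bot ℂ).1 (hAB ▸ mem_undampedSpace hBw hAw))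

variable {z : ℝ → ι → ℂ}

theorem IsDampedMotion.tendsto_zero (hz : IsDampedMotion A B z) (hA : A.PosDef)
    (hB : B.PosSemidef) (hAB : undampedSpace A B = ⊥) : Tendsto z atTop (𝓝 0) := by
  obtain ⟨v, a, hv, ha, hz⟩ := hz
  let F : Module.End ℂ ((ι → ℂ) × (ι → ℂ)) :=
    (LinearMap.snd ℂ _ _).prod (-(A.mulVecLin ∘ₗ LinearMap.fst ℂ _ _)
      - B.mulVecLin ∘ₗ LinearMap.snd ℂ _ _)
  have hF (p r : ι → ℂ) : F (p, r) = (r, -(A *ᵥ p) - B *ᵥ r) := rfl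
  have hderiv (t : ℝ) : HasDerivAt (fun t => (z t, v t)) (F (z t, v t)) t := by
    have : a t = -(A *ᵥ z t) - B *ᵥ v t := by
      rw [← sub_eq_zero, ← hz t]; abel
    rw [hF, ← this]
    exact (hv t).prodMk (ha t)
  have hurwitz (μ : ℂ) (hμ : F.HasEigenvalue μ) : μ.re < 0 := by
    obtain ⟨⟨p, r⟩, hpr⟩ := hμ.exists_hasEigenvector
    have heig := hpr.apply_eq_smul
    rw [hF, Prod.smul_mk, Prod.mk.injEq] at heig
    obtain ⟨rfl, hp⟩ := heig
    refine re_neg_of_undampedSpace_eq_bot hA hB hAB (s := μ) (w := p) ?_ ?_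
    · rintro rfl
      exact hpr.2 (by simp)
    · rw [Matrix.mulVec_smul, smul_smul, ← pow_two] at hp
      rw [← hp]; abel
  exact (continuous_fst.tendsto' _ _ rfl).comp (tendsto_zero_of_hasEigenvalue_re_neg hurwitz hderiv)

theorem isDampedMotion_exp {w : ι → ℂ} {ω : ℝ} (hBw : B *ᵥ w = 0)
    (hAw : A *ᵥ w = (ω ^ 2 : ℂ) • w) :
    IsDampedMotion A B fun t => Complex.exp (Complex.I * ω * t) • w := by
  have hexp (t : ℝ) : HasDerivAt (fun t : ℝ => Complex.exp (Complex.I * ω * t))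
      (Complex.I * ω * Complex.exp (Complex.I * ω * t)) t :=
    ((hasDerivAt_id' t).ofReal_comp.const_mul (Complex.I * ω)).cexp.congr_deriv (by simp; ring)
  refine ⟨_, _, fun t => (hexp t).smul_const w,
    fun t => ((hexp t).const_mul (Complex.I * ω)).smul_const w, fun t => ?_⟩
  rw [Matrix.mulVec_smul, Matrix.mulVec_smul, hBw, hAw, smul_zero, add_zero, smul_smul, ← add_smul]
  have : Complex.I * ω * (Complex.I * ω * Complex.exp (Complex.I * ω * t))
      + Complex.exp (Complex.I * ω * t) * ω ^ 2 = 0 := by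
    linear_combination Complex.exp (Complex.I * ω * t) * ω ^ 2 * Complex.I_sq
  rw [this, zero_smul]

theorem nonneg_of_posSemidef_mulVec_eq_smul (hA : A.PosSemidef) {w : ι → ℂ} (hw : w ≠ 0) {c : ℝ}
    (hAw : A *ᵥ w = (c : ℂ) • w) : 0 ≤ c := by
  have hform : 0 ≤ (c : ℂ) * (star w ⬝ᵥ w) := by
    simpa [hAw] using hA.dotProduct_mulVec_nonneg w
  obtain ⟨d, hd, hd'⟩ :=
    RCLike.pos_iff_exists_ofReal.1 (Matrix.dotProduct_star_self_pos_iff.2 hw)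
  have hcd : 0 ≤ ((c * d : ℝ) : ℂ) := by simpa [← hd'] using hform
  exact nonneg_of_mul_nonneg_left (Complex.zero_le_real.1 hcd) hd

theorem undampedSpace_le_ker_of_tendsto_zero {κ : Type*} (hA : A.PosSemidef)
    {C : Matrix κ ι ℂ}
    (h : ∀ z, IsDampedMotion A B z → Tendsto (fun t => C *ᵥ z t) atTop (𝓝 0)) :
    undampedSpace A B ≤ LinearMap.ker C.mulVecLin := by
  refine undampedSpace_le_iff.2 fun w c hBw hAw => ?_
  rcases eq_or_ne w 0 with rfl | hw
  · exact zero_mem _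
  have hc := nonneg_of_posSemidef_mulVec_eq_smul hA hw hAw
  have hmotion := h _ (isDampedMotion_exp (ω := √c) hBw
    (by rw [← Complex.ofReal_pow, Real.sq_sqrt hc, hAw]))
  ext i
  have hnorm (t : ℝ) :
      ‖(C *ᵥ (Complex.exp (Complex.I * √c * t) • w)) i‖ = ‖(C *ᵥ w) i‖ := by
    simp [Matrix.mulVec_smul, Complex.norm_exp]
  have hconst := (tendsto_pi_nhds.1 hmotion i).norm
  simp only [hnorm, Pi.zero_apply, norm_zero] at hconst
  exact norm_eq_zero.1 (tendsto_nhds_unique tendsto_const_nhds hconst)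

end DampedMotion

section StarProjection

theorem posSemidef_of_isStarProjection {𝕜 ι : Type*} [RCLike 𝕜] [Fintype ι]
    {J : Matrix ι ι 𝕜} (hJ : IsStarProjection J) : J.PosSemidef := by
  have := Matrix.posSemidef_conjTranspose_mul_self J
  rwa [← Matrix.star_eq_conjTranspose, hJ.isSelfAdjoint.star_eq, hJ.isIdempotentElem.eq] at this

theorem ker_one_sub_mulVecLin_eq_range {R ι : Type*} [CommRing R] [Fintype ι] [DecidableEq ι]
    {J : Matrix ι ι R} (hJ : IsIdempotentElem J) :
    LinearMap.ker (1 - J).mulVecLin = LinearMap.range J.mulVecLin := by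
  have hlin : IsIdempotentElem J.mulVecLin := by
    rw [IsIdempotentElem, Module.End.mul_eq_comp, ← Matrix.mulVecLin_mul, hJ.eq]
  rw [LinearMap.IsIdempotentElem.range_eq_ker hlin, ← Matrix.mulVecLin_one,
    ← map_sub (Matrix.mulVecBilin R R)]

variable {ι : Type*} [Fintype ι] {A B J : Matrix ι ι ℂ}

theorem range_le_undampedSpace (hA : A.IsHermitian) (hAJ : Commute A J) (hBJ : B * J = 0) :
    LinearMap.range J.mulVecLin ≤ undampedSpace A B := by
  classical
  let e := hA.eigenvectorBasis.toBasis.map (WithLp.linearEquiv 2 ℂ (ι → ℂ))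
  rw [LinearMap.range_eq_map, ← e.span_eq, Submodule.map_span_le]
  rintro _ ⟨j, rfl⟩
  have he : e j = ⇑(hA.eigenvectorBasis j) := rfl
  refine mem_undampedSpace (c := hA.eigenvalues j) ?_ ?_
  · rw [Matrix.mulVecLin_apply, Matrix.mulVec_mulVec, hBJ, Matrix.zero_mulVec]
  · rw [Matrix.mulVecLin_apply, Matrix.mulVec_mulVec, hAJ.eq, ← Matrix.mulVec_mulVec, he,
      hA.mulVec_eigenvectorBasis, ← Matrix.mulVec_smul, Complex.coe_smul]

variable [DecidableEq ι]

theorem undampedSpace_add_eq_bot (hJ : IsStarProjection J) (hJB : J * B = 0)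
    (h : undampedSpace A B ≤ LinearMap.ker (1 - J).mulVecLin) : undampedSpace A (B + J) = ⊥ := by
  refine eq_bot_iff.2 (undampedSpace_le_iff.2 fun w c hBJw hAw => ?_)
  have hJw : J *ᵥ w = 0 := by
    simpa [mul_add, hJB, hJ.isIdempotentElem.eq] using congrArg (J *ᵥ ·) hBJw
  have hBw : B *ᵥ w = 0 := by simpa [Matrix.add_mulVec, hJw] using hBJw
  have hw : (1 - J) *ᵥ w = 0 := h (mem_undampedSpace hBw hAw)
  simpa [Matrix.sub_mulVec, hJw] using hw

theorem IsDampedMotion.one_sub_mulVec {z : ℝ → ι → ℂ} (hz : IsDampedMotion A B z)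
    (hJ : IsIdempotentElem J) (hAJ : Commute A J) (hBJ : B * J = 0) (hJB : J * B = 0) :
    IsDampedMotion A (B + J) fun t => (1 - J) *ᵥ z t := by
  have hA : (1 - J) * A = A * (1 - J) := ((Commute.one_right A).sub_right hAJ).eq.symm
  have hB : (1 - J) * B = (B + J) * (1 - J) := by
    simp [mul_sub, sub_mul, add_mul, hBJ, hJB, hJ.eq]
  refine hz.map ((1 - J).mulVecLin.restrictScalars ℝ) (fun w => ?_) (fun w => ?_)
  · simp only [LinearMap.restrictScalars_apply, Matrix.mulVecLin_apply, Matrix.mulVec_mulVec, hA]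
  · simp only [LinearMap.restrictScalars_apply, Matrix.mulVecLin_apply, Matrix.mulVec_mulVec, hB]

theorem tendsto_one_sub_mulVec_iff_undampedSpace_le (hA : A.PosDef) (hB : B.PosSemidef)
    (hJ : IsStarProjection J) (hAJ : Commute A J) (hBJ : B * J = 0) :
    (∀ z, IsDampedMotion A B z → Tendsto (fun t => (1 - J) *ᵥ z t) atTop (𝓝 0)) ↔
      undampedSpace A B ≤ LinearMap.ker (1 - J).mulVecLin := by
  refine ⟨undampedSpace_le_ker_of_tendsto_zero hA.posSemidef, fun h z hz => ?_⟩
  have hJB : J * B = 0 := by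
    simpa [Matrix.star_eq_conjTranspose, hB.isHermitian.eq,
      ← Matrix.star_eq_conjTranspose J, hJ.isSelfAdjoint.star_eq] using congrArg star hBJ
  exact (hz.one_sub_mulVec hJ.isIdempotentElem hAJ hBJ hJB).tendsto_zero hA
    (hB.add (posSemidef_of_isStarProjection hJ)) (undampedSpace_add_eq_bot hJ hJB h)

theorem tendsto_one_sub_mulVec_iff_reLambda (hA : A.PosDef) (hB : B.PosSemidef)
    (hJ : IsStarProjection J) (hAJ : Commute A J) (hBJ : B * J = 0)
    (hrank : J.rank < Fintype.card ι) :
    (∀ z, IsDampedMotion A B z → Tendsto (fun t => (1 - J) *ᵥ z t) atTop (𝓝 0)) ↔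
      0 < reLambda (J.rank + 1) (B + Complex.I • A) := by
  rw [tendsto_one_sub_mulVec_iff_undampedSpace_le hA hB hJ hAJ hBJ,
    ker_one_sub_mulVecLin_eq_range hJ.isIdempotentElem]
  exact (zero_lt_reLambda_iff_undampedSpace_le hA.isHermitian hB
    (range_le_undampedSpace hA.isHermitian hAJ hBJ) hrank).symm

end StarProjection

section IdempotentRank

variable {𝕜 𝕜' ι : Type*} [Field 𝕜] [Field 𝕜'] [Fintype ι] {J : Matrix ι ι 𝕜}

theorem trace_eq_rank_of_isIdempotentElem (hJ : IsIdempotentElem J) : J.trace = J.rank := by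
  classical
  have hlin : IsIdempotentElem J.toLin' := hJ.map Matrix.toLinAlgEquiv'
  rw [← Matrix.trace_toLin'_eq, (LinearMap.IsIdempotentElem.isProj_range _ hlin).trace]
  rfl

theorem rank_map_of_isIdempotentElem [CharZero 𝕜'] (f : 𝕜 →+* 𝕜') (hJ : IsIdempotentElem J) :
    (J.map f).rank = J.rank := by
  classical
  have hcast := calc ((J.map f).rank : 𝕜')
    _ = (J.map f).trace := (trace_eq_rank_of_isIdempotentElem (hJ.map f.mapMatrix)).symm
    _ = f J.trace := (AddMonoidHom.map_trace f.toAddMonoidHom J).symm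
    _ = J.rank := by rw [trace_eq_rank_of_isIdempotentElem hJ, map_natCast]
  exact_mod_cast hcast

end IdempotentRank

section RealMatrices

theorem map_ofReal_mul {ι κ μ : Type*} [Fintype κ] (X : Matrix ι κ ℝ) (Y : Matrix κ μ ℝ) :
    (X * Y).map Complex.ofReal = X.map Complex.ofReal * Y.map Complex.ofReal :=
  Matrix.map_mul (f := Complex.ofRealHom)

open scoped MatrixOrder in
theorem posSemidef_map_ofReal {ι : Type*} [Finite ι] {A : Matrix ι ι ℝ} (hA : A.PosSemidef) :
    (A.map Complex.ofReal).PosSemidef := by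
  classical
  have := Fintype.ofFinite ι
  obtain ⟨S, rfl⟩ := CStarAlgebra.nonneg_iff_eq_star_mul_self.1 hA.nonneg
  have hS : (star S * S).map Complex.ofReal =
      (S.map Complex.ofReal)ᴴ * S.map Complex.ofReal := by
    rw [← Matrix.conjTranspose_map _ fun r => (Complex.conj_ofReal r).symm, ← map_ofReal_mul,
      Matrix.star_eq_conjTranspose]
  rw [hS]
  exact Matrix.posSemidef_conjTranspose_mul_self _

theorem posDef_map_ofReal {ι : Type*} [Finite ι] {A : Matrix ι ι ℝ} (hA : A.PosDef) :
    (A.map Complex.ofReal).PosDef := by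
  classical
  have := Fintype.ofFinite ι
  rw [(posSemidef_map_ofReal hA.posSemidef).posDef_iff_det_ne_zero]
  have hdet : (A.map Complex.ofReal).det = A.det := (Complex.ofRealHom.map_det A).symm
  rw [hdet]
  exact_mod_cast hA.det_pos.ne'

variable {ι κ : Type*} [Fintype ι] {A B : Matrix ι ι ℝ} {C : Matrix κ ι ℝ}

theorem ofReal_comp_mulVec (C : Matrix κ ι ℝ) (w : ι → ℝ) :
    Complex.ofReal ∘ (C *ᵥ w) = C.map Complex.ofReal *ᵥ (Complex.ofReal ∘ w) :=
  funext fun i => Complex.ofRealHom.map_mulVec C w i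

theorem re_comp_map_ofReal_mulVec (C : Matrix κ ι ℝ) (w : ι → ℂ) :
    Complex.re ∘ (C.map Complex.ofReal *ᵥ w) = C *ᵥ (Complex.re ∘ w) := by
  ext i
  simp [Matrix.mulVec, dotProduct]

theorem im_comp_map_ofReal_mulVec (C : Matrix κ ι ℝ) (w : ι → ℂ) :
    Complex.im ∘ (C.map Complex.ofReal *ᵥ w) = C *ᵥ (Complex.im ∘ w) := by
  ext i
  simp [Matrix.mulVec, dotProduct]

theorem forall_tendsto_mulVec_map_ofReal_iff :
    (∀ z, IsDampedMotion (A.map Complex.ofReal) (B.map Complex.ofReal) z →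
      Tendsto (fun t => C.map Complex.ofReal *ᵥ z t) atTop (𝓝 0)) ↔
    ∀ z, IsDampedMotion A B z → Tendsto (fun t => C *ᵥ z t) atTop (𝓝 0) := by
  simp only [tendsto_pi_nhds, Pi.zero_apply]
  constructor <;> intro h z hz i
  · rw [← tendsto_ofReal_iff, Complex.ofReal_zero]
    exact (h _ (hz.map (Complex.ofRealCLM.toLinearMap.compLeft ι) (ofReal_comp_mulVec A)
      (ofReal_comp_mulVec B)) i).congr fun t => (congrFun (ofReal_comp_mulVec C (z t)) i).symm
  · have hre := (h _ (hz.map (Complex.reLm.compLeft ι) (re_comp_map_ofReal_mulVec A)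
      (re_comp_map_ofReal_mulVec B)) i).congr
      fun t => (congrFun (re_comp_map_ofReal_mulVec C (z t)) i).symm
    have him := (h _ (hz.map (Complex.imLm.compLeft ι) (im_comp_map_ofReal_mulVec A)
      (im_comp_map_ofReal_mulVec B)) i).congr
      fun t => (congrFun (im_comp_map_ofReal_mulVec C (z t)) i).symm
    simpa using (hre.ofReal.add (him.ofReal.mul_const Complex.I)).congr
      fun t => Complex.re_add_im _

variable {J : Matrix ι ι ℝ}

theorem isStarProjection_map_ofReal (hJ : IsStarProjection J) :
    IsStarProjection (J.map Complex.ofReal) where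
  isIdempotentElem := by rw [IsIdempotentElem, ← map_ofReal_mul, hJ.isIdempotentElem.eq]
  isSelfAdjoint := by
    have := congrArg (·.map Complex.ofReal) hJ.isSelfAdjoint.star_eq
    rwa [Matrix.star_eq_conjTranspose,
      Matrix.conjTranspose_map _ fun r => (Complex.conj_ofReal r).symm] at this

theorem tendsto_one_sub_mulVec_iff_reLambda_toComplex [DecidableEq ι] (hA : A.PosDef)
    (hB : B.PosSemidef) (hJ : IsStarProjection J) (hAJ : Commute A J) (hBJ : B * J = 0)
    (hrank : J.rank < Fintype.card ι) :
    (∀ z, IsDampedMotion A B z → Tendsto (fun t => (1 - J) *ᵥ z t) atTop (𝓝 0)) ↔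
      0 < reLambda (J.rank + 1) (toComplex B A) := by
  let cast := Complex.ofRealHom.mapMatrix (m := ι)
  have hJ' : (1 - J).map Complex.ofReal = 1 - J.map Complex.ofReal := by
    exact (map_sub cast 1 J).trans (by rw [map_one]; rfl)
  have hrankJ := rank_map_of_isIdempotentElem Complex.ofRealHom hJ.isIdempotentElem
  rw [← forall_tendsto_mulVec_map_ofReal_iff, hJ', ← hrankJ]
  refine tendsto_one_sub_mulVec_iff_reLambda (posDef_map_ofReal hA) (posSemidef_map_ofReal hB)
    (isStarProjection_map_ofReal hJ) (hAJ.map cast)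
    (by rw [← map_ofReal_mul, hBJ]; exact map_zero cast) (hrankJ.trans_lt hrank)

end RealMatrices

section Laplacian

variable {q n : ℕ} {W : Fin q → Fin q → Matrix (Fin n) (Fin n) ℝ}

theorem lap_mulVec_apply (hW : ∀ i, W i i = 0) (z : Fin q × Fin n → ℝ) (i : Fin q) (a : Fin n) :
    (lap W *ᵥ z) (i, a) = (∑ j, W i j *ᵥ fun b => z (i, b) - z (j, b)) a := by
  have hentry (j : Fin q) (b : Fin n) : lap W (i, a) (j, b) =
      (if i = j then ∑ l, W i l a b else 0) - W i j a b := by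
    by_cases hij : i = j
    · subst hij
      simp [lap, Matrix.sum_apply, hW]
    · simp [lap, hij]
  simp only [Finset.sum_apply, Matrix.mulVec, dotProduct, Fintype.sum_prod_type, hentry, sub_mul,
    mul_sub, Finset.sum_sub_distrib, ite_mul, zero_mul]
  congr 1
  rw [Finset.sum_comm]
  simp only [Finset.sum_ite_eq, Finset.mem_univ, if_true, Finset.sum_mul]
  exact Finset.sum_comm

theorem IsCoupling.conj (hW : IsCoupling W) {C : Matrix (Fin n) (Fin n) ℝ}
    (hC : C.IsHermitian) : IsCoupling fun i j => C * W i j * C where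
  posSemidef i j := by
    simpa only [hC.eq] using (hW.posSemidef i j).conjTranspose_mul_mul_same C
  symm i j := by rw [hW.symm]
  diag i := by simp [hW.diag]

theorem IsCoupling.isHermitian_lap (hW : IsCoupling W) : (lap W).IsHermitian := by
  have hentry (i j : Fin q) (a b : Fin n) : W i j a b = W i j b a := by
    simpa using (hW.posSemidef i j).isHermitian.apply b a
  refine Matrix.IsHermitian.ext ?_
  rintro ⟨i, a⟩ ⟨j, b⟩
  by_cases hij : i = j
  · subst hij
    simp [lap, Matrix.sum_apply, hentry i _ a b]
  · simp [lap, hij, Ne.symm hij, hW.symm j i, hentry i j b a]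

theorem IsCoupling.two_mul_dotProduct_lap_mulVec (hW : IsCoupling W) (z : Fin q × Fin n → ℝ) :
    2 * (z ⬝ᵥ lap W *ᵥ z) = ∑ i, ∑ j, (fun b => z (i, b) - z (j, b)) ⬝ᵥ
      W i j *ᵥ fun b => z (i, b) - z (j, b) := by
  let d (i j : Fin q) (b : Fin n) := z (i, b) - z (j, b)
  have hfst : z ⬝ᵥ lap W *ᵥ z = ∑ i, ∑ j, (fun b => z (i, b)) ⬝ᵥ W i j *ᵥ d i j := by
    simp only [dotProduct, Fintype.sum_prod_type, lap_mulVec_apply hW.diag, Finset.sum_apply,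
      Finset.mul_sum]
    exact Finset.sum_congr rfl fun i _ => Finset.sum_comm
  have hsnd : z ⬝ᵥ lap W *ᵥ z = -∑ i, ∑ j, (fun b => z (j, b)) ⬝ᵥ W i j *ᵥ d i j := by
    rw [hfst, Finset.sum_comm]
    simp only [← Finset.sum_neg_distrib]
    refine Finset.sum_congr rfl fun i _ => Finset.sum_congr rfl fun j _ => ?_
    have hd : d j i = -d i j := by ext b; simp [d]
    rw [hW.symm j i, hd, Matrix.mulVec_neg, dotProduct_neg]
  have hadd : 2 * (z ⬝ᵥ lap W *ᵥ z) = z ⬝ᵥ lap W *ᵥ z - -(z ⬝ᵥ lap W *ᵥ z) := by ring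
  rw [hadd]
  nth_rw 1 [hfst]
  rw [hsnd, neg_neg]
  simp only [← Finset.sum_sub_distrib, ← sub_dotProduct]
  rfl

theorem IsCoupling.posSemidef_lap (hW : IsCoupling W) : (lap W).PosSemidef := by
  refine .of_dotProduct_mulVec_nonneg hW.isHermitian_lap fun z => ?_
  have hsum : 0 ≤ 2 * (z ⬝ᵥ lap W *ᵥ z) := by
    rw [hW.two_mul_dotProduct_lap_mulVec]
    exact Finset.sum_nonneg fun i _ => Finset.sum_nonneg fun j _ =>
      by simpa using (hW.posSemidef i j).dotProduct_mulVec_nonneg fun b => z (i, b) - z (j, b)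
  simpa using hsum

end Laplacian

section SyncProj

/-- The orthogonal projection of `(ℝⁿ)^q` onto the synchronous states `x₁ = ⋯ = x_q`: every
block is replaced by the average of all blocks. -/
noncomputable def syncProj (q n : ℕ) : Matrix (Fin q × Fin n) (Fin q × Fin n) ℝ :=
  (Matrix.of fun _ _ => (q : ℝ)⁻¹) ⊗ₖ 1

variable {q n : ℕ} {W : Fin q → Fin q → Matrix (Fin n) (Fin n) ℝ}

theorem syncProj_mulVec_apply (z : Fin q × Fin n → ℝ) (i : Fin q) (a : Fin n) :
    (syncProj q n *ᵥ z) (i, a) = (q : ℝ)⁻¹ * ∑ j, z (j, a) := by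
  simp [syncProj, Matrix.mulVec, dotProduct, Fintype.sum_prod_type, Matrix.one_apply,
    Finset.mul_sum]

theorem isStarProjection_syncProj : IsStarProjection (syncProj q n) where
  isIdempotentElem := by
    rw [IsIdempotentElem, syncProj, ← Matrix.mul_kronecker_mul, one_mul]
    congr 1
    ext i j
    have : (q : ℝ) ≠ 0 := by exact_mod_cast i.pos.ne'
    simp [Matrix.mul_apply, this]
  isSelfAdjoint := by
    ext ⟨i, a⟩ ⟨j, b⟩
    simp [syncProj, Matrix.one_apply, eq_comm]

theorem rank_syncProj (hq : q ≠ 0) : (syncProj q n).rank = n := by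
  have hq' : (q : ℝ) ≠ 0 := by exact_mod_cast hq
  have htrace : (syncProj q n).trace = n := by
    rw [syncProj, Matrix.trace_kronecker]
    simp [Matrix.trace, hq']
  rw [trace_eq_rank_of_isIdempotentElem isStarProjection_syncProj.isIdempotentElem] at htrace
  exact_mod_cast htrace

theorem lap_mul_syncProj (hW : ∀ i, W i i = 0) : lap W * syncProj q n = 0 := by
  refine Matrix.ext_of_mulVec_single fun p => ?_
  ext ⟨i, a⟩
  rw [← Matrix.mulVec_mulVec, Matrix.zero_mulVec, lap_mulVec_apply hW]
  simp only [syncProj_mulVec_apply, sub_self]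
  simp [← Pi.zero_def]

theorem IsCoupling.syncProj_mul_lap (hW : IsCoupling W) : syncProj q n * lap W = 0 := by
  have h := congrArg star (lap_mul_syncProj (n := n) hW.diag)
  rwa [star_mul, star_zero, isStarProjection_syncProj.isSelfAdjoint.star_eq,
    Matrix.star_eq_conjTranspose, hW.isHermitian_lap.eq] at h

theorem tendsto_one_sub_syncProj_mulVec_iff {α : Type*} {l : Filter α}
    {z : α → Fin q × Fin n → ℝ} :
    Tendsto (fun t => (1 - syncProj q n) *ᵥ z t) l (𝓝 0) ↔
      ∀ i j a, Tendsto (fun t => z t (i, a) - z t (j, a)) l (𝓝 0) := by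
  rw [tendsto_pi_nhds]
  refine ⟨fun h i j a => ?_, fun h ⟨i, a⟩ => ?_⟩
  · simpa [Matrix.sub_mulVec, syncProj_mulVec_apply] using (h (i, a)).sub (h (j, a))
  · have hq : (q : ℝ) ≠ 0 := by exact_mod_cast i.pos.ne'
    have havg (t : α) : ((1 - syncProj q n) *ᵥ z t) (i, a) =
        (q : ℝ)⁻¹ * ∑ j, (z t (i, a) - z t (j, a)) := by
      simp [Matrix.sub_mulVec, syncProj_mulVec_apply, mul_sub, hq]
    simp only [havg]
    simpa using (tendsto_finsetSum Finset.univ fun j _ => h i j a).const_mul (q : ℝ)⁻¹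

end SyncProj

section Array

variable {q n : ℕ} {M K B C P : Matrix (Fin n) (Fin n) ℝ}
  {D R : Fin q → Fin q → Matrix (Fin n) (Fin n) ℝ} {ε : ℝ}

theorem synchronizes_iff_tendsto_sub : Synchronizes M K D R ε ↔
    ∀ x, IsSolution M K D R ε x → ∀ i j, Tendsto (fun t => x i t - x j t) atTop (𝓝 0) := by
  have hnorm (y : ℝ → Fin n → ℝ) : Tendsto (fun t => ‖WithLp.toLp 2 (y t)‖) atTop (𝓝 0) ↔
      Tendsto y atTop (𝓝 0) := by
    rw [← tendsto_zero_iff_norm_tendsto_zero]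
    exact ((PiLp.homeomorph 2 fun _ : Fin n => ℝ).symm.isInducing.tendsto_nhds_iff (y := 0)).symm
  simp only [Synchronizes, hnorm]

theorem isSolution_of_isSolution_mul (hB : IsUnit B) {x : Fin q → ℝ → Fin n → ℝ}
    (hx : IsSolution (B * M * C) (B * K * C) (fun i j => B * D i j * C)
      (fun i j => B * R i j * C) ε x) :
    IsSolution M K D R ε fun i t => C *ᵥ x i t := by
  obtain ⟨v, a, hv, ha, h⟩ := hx
  refine ⟨fun i t => C *ᵥ v i t, fun i t => C *ᵥ a i t,
    fun i t => hasDerivAt_linearMap_comp C.mulVecLin (hv i t),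
    fun i t => hasDerivAt_linearMap_comp C.mulVecLin (ha i t), fun i t => ?_⟩
  apply Matrix.mulVec_injective_of_isUnit hB
  simpa [Matrix.mulVec_add, Matrix.mulVec_smul, Matrix.mulVec_sum, ← Matrix.mulVec_sub,
    Matrix.mul_assoc] using h i t

theorem Synchronizes.mul (h : Synchronizes M K D R ε) (hB : IsUnit B) (hC : IsUnit C) :
    Synchronizes (B * M * C) (B * K * C) (fun i j => B * D i j * C)
      (fun i j => B * R i j * C) ε := by
  rw [synchronizes_iff_tendsto_sub] at h ⊢
  intro x hx i j
  have hC' : C⁻¹ * C = 1 := Matrix.nonsing_inv_mul C ((Matrix.isUnit_iff_isUnit_det C).1 hC)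
  have hlim := ((Matrix.mulVecLin C⁻¹).continuous_of_finiteDimensional.tendsto 0).comp
    (h _ (isSolution_of_isSolution_mul hB hx) i j)
  simpa [Function.comp_def, ← Matrix.mulVec_sub, hC'] using hlim

theorem synchronizes_mul_iff (hB : IsUnit B) (hC : IsUnit C) :
    Synchronizes (B * M * C) (B * K * C) (fun i j => B * D i j * C)
      (fun i j => B * R i j * C) ε ↔ Synchronizes M K D R ε := by
  refine ⟨fun h => ?_, fun h => h.mul hB hC⟩
  have hB' : B⁻¹ * B = 1 := Matrix.nonsing_inv_mul B ((Matrix.isUnit_iff_isUnit_det B).1 hB)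
  have hC' : C * C⁻¹ = 1 := Matrix.mul_nonsing_inv C ((Matrix.isUnit_iff_isUnit_det C).1 hC)
  have hcancel (X : Matrix (Fin n) (Fin n) ℝ) : B⁻¹ * (B * X * C) * C⁻¹ = X := by
    rw [mul_assoc B, ← mul_assoc, hB', one_mul, mul_assoc, hC', mul_one]
  simpa only [hcancel] using h.mul (Matrix.isUnit_nonsing_inv_iff.2 hB)
    (Matrix.isUnit_nonsing_inv_iff.2 hC)

theorem one_kronecker_mulVec_apply (P : Matrix (Fin n) (Fin n) ℝ) (z : Fin q × Fin n → ℝ)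
    (i : Fin q) (a : Fin n) :
    (((1 : Matrix (Fin q) (Fin q) ℝ) ⊗ₖ P) *ᵥ z) (i, a) = (P *ᵥ fun b => z (i, b)) a := by
  simp [Matrix.mulVec, dotProduct, Fintype.sum_prod_type, Matrix.one_apply, ite_mul]

/-- The stiffness matrix `[I_q ⊗ P] + ε lap (Rᵢⱼ)` of an array of oscillators with unit masses
and stiffness `P`. -/
def stiffness (P : Matrix (Fin n) (Fin n) ℝ) (R : Fin q → Fin q → Matrix (Fin n) (Fin n) ℝ)
    (ε : ℝ) : Matrix (Fin q × Fin n) (Fin q × Fin n) ℝ :=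
  1 ⊗ₖ P + ε • lap R

theorem posDef_stiffness (hP : P.PosDef) (hR : IsCoupling R) (hε : 0 ≤ ε) :
    (stiffness P R ε).PosDef :=
  (Matrix.PosDef.one.kronecker hP).add_posSemidef (hR.posSemidef_lap.smul hε)

theorem commute_stiffness_syncProj (hR : IsCoupling R) :
    Commute (stiffness P R ε) (syncProj q n) := by
  have hkron : Commute ((1 : Matrix (Fin q) (Fin q) ℝ) ⊗ₖ P) (syncProj q n) := by
    rw [commute_iff_eq, syncProj, ← Matrix.mul_kronecker_mul, ← Matrix.mul_kronecker_mul]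
    simp only [one_mul, mul_one]
  have hlap : Commute (lap R) (syncProj q n) :=
    (lap_mul_syncProj hR.diag).trans hR.syncProj_mul_lap.symm
  exact hkron.add_left (hlap.smul_left ε)

theorem isSolution_one_iff_isDampedMotion (hD : ∀ i, D i i = 0) (hR : ∀ i, R i i = 0)
    {z : ℝ → Fin q × Fin n → ℝ} :
    IsSolution 1 P D R ε (fun i t a => z t (i, a)) ↔
      IsDampedMotion (stiffness P R ε) (lap D) z := by
  have hforce (z v a : Fin q × Fin n → ℝ) (i : Fin q) (b : Fin n) :
      ((1 : Matrix (Fin n) (Fin n) ℝ) *ᵥ (fun b => a (i, b)) + P *ᵥ (fun b => z (i, b))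
        + ∑ j, D i j *ᵥ ((fun b => v (i, b)) - fun b => v (j, b))
        + ε • ∑ j, R i j *ᵥ ((fun b => z (i, b)) - fun b => z (j, b))) b =
      (a + lap D *ᵥ v + stiffness P R ε *ᵥ z) (i, b) := by
    simp only [stiffness, Matrix.add_mulVec, Matrix.smul_mulVec, Pi.add_apply, Pi.smul_apply,
      lap_mulVec_apply hD, lap_mulVec_apply hR, one_kronecker_mulVec_apply, Matrix.one_mulVec]
    rw [add_assoc, add_assoc, add_assoc]
    exact congrArg (a (i, b) + ·) (add_left_comm _ _ _)
  constructor
  · rintro ⟨v, a, hv, ha, h⟩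
    refine ⟨fun t r => v r.1 t r.2, fun t r => a r.1 t r.2, fun t => hasDerivAt_pi.2 fun r =>
      hasDerivAt_pi.1 (hv r.1 t) r.2, fun t => hasDerivAt_pi.2 fun r =>
      hasDerivAt_pi.1 (ha r.1 t) r.2, fun t => funext fun ⟨i, b⟩ => ?_⟩
    exact (hforce _ _ _ i b).symm.trans (congrFun (h i t) b)
  · rintro ⟨v, a, hv, ha, h⟩
    refine ⟨fun i t b => v t (i, b), fun i t b => a t (i, b), fun i t => hasDerivAt_pi.2 fun b =>
      hasDerivAt_pi.1 (hv t) (i, b), fun i t => hasDerivAt_pi.2 fun b =>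
      hasDerivAt_pi.1 (ha t) (i, b), fun i t => funext fun b => ?_⟩
    exact (hforce _ _ _ i b).trans (congrFun (h t) (i, b))

theorem synchronizes_one_iff (hD : ∀ i, D i i = 0) (hR : ∀ i, R i i = 0) :
    Synchronizes 1 P D R ε ↔ ∀ z, IsDampedMotion (stiffness P R ε) (lap D) z →
      Tendsto (fun t => (1 - syncProj q n) *ᵥ z t) atTop (𝓝 0) := by
  simp only [tendsto_one_sub_syncProj_mulVec_iff]
  simp only [synchronizes_iff_tendsto_sub, ← isSolution_one_iff_isDampedMotion hD hR,
    tendsto_pi_nhds]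
  exact ⟨fun h z hz => h _ hz, fun h x hx => h (fun t r => x r.1 t r.2) hx⟩

open scoped MatrixOrder in
theorem posDef_invSqrt (hM : M.PosDef) : (invSqrt M).PosDef :=
  (Matrix.isStrictlyPositive_iff_posDef.1 (IsStrictlyPositive.sqrt M hM.isStrictlyPositive)).inv

open scoped MatrixOrder in
theorem invSqrt_mul_mul_invSqrt (hM : M.PosDef) : invSqrt M * M * invSqrt M = 1 := by
  have hdet : IsUnit (CFC.sqrt M).det :=
    (Matrix.isUnit_iff_isUnit_det _).1 hM.isStrictlyPositive.sqrt.isUnit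
  have hsqrt : CFC.sqrt M * CFC.sqrt M = M := CFC.sqrt_mul_sqrt_self M hM.posSemidef.nonneg
  nth_rw 2 [← hsqrt]
  rw [invSqrt, ← mul_assoc, Matrix.nonsing_inv_mul _ hdet, one_mul, Matrix.mul_nonsing_inv _ hdet]

theorem posDef_oscP (hM : M.PosDef) (hK : K.PosDef) : (oscP M K).PosDef := by
  have hS := posDef_invSqrt hM
  have hconj := hK.conjTranspose_mul_mul_same (Matrix.mulVec_injective_of_isUnit hS.isUnit)
  rwa [hS.isHermitian.eq] at hconj

theorem synchronizes_iff_reLambda_Gam (hq : 2 ≤ q) (hn : 1 ≤ n) (hM : M.PosDef) (hK : K.PosDef)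
    (hD : IsCoupling D) (hR : IsCoupling R) (hε : 0 ≤ ε) :
    Synchronizes M K D R ε ↔ 0 < reLambda (n + 1) (Gam M K D R ε) := by
  have hS := posDef_invSqrt hM
  have hD' := hD.conj hS.isHermitian
  have hR' := hR.conj hS.isHermitian
  have hrank := rank_syncProj (n := n) (q := q) (by omega)
  have hcard : n < Fintype.card (Fin q × Fin n) := by
    rw [Fintype.card_prod, Fintype.card_fin, Fintype.card_fin]
    nlinarith
  rw [← synchronizes_mul_iff hS.isUnit hS.isUnit, invSqrt_mul_mul_invSqrt hM, ← oscP,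
    synchronizes_one_iff hD'.diag hR'.diag,
    tendsto_one_sub_mulVec_iff_reLambda_toComplex (posDef_stiffness (posDef_oscP hM hK) hR' hε)
      hD'.posSemidef_lap isStarProjection_syncProj (commute_stiffness_syncProj hR')
      (lap_mul_syncProj hD'.diag) (hrank.trans_lt hcard), hrank]
  rfl

end Array

section Modal

variable {q n : ℕ} {M K P : Matrix (Fin n) (Fin n) ℝ} {σ : Fin n → ℝ} {v : Fin n → Fin n → ℝ}

theorem mul_transpose_eq_one_of_eigenvectors (hP : P.IsHermitian) (hσ : Function.Injective σ)
    (hv_unit : ∀ k, v k ⬝ᵥ v k = 1) (hv : ∀ k, P *ᵥ v k = σ k • v k) :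
    Matrix.of v * (Matrix.of v)ᵀ = 1 := by
  ext k l
  change v k ⬝ᵥ v l = (1 : Matrix (Fin n) (Fin n) ℝ) k l
  rcases eq_or_ne k l with rfl | hkl
  · rw [hv_unit, Matrix.one_apply_eq]
  · have hsymm : σ l * (v k ⬝ᵥ v l) = σ k * (v k ⬝ᵥ v l) := by
      rw [← smul_eq_mul, ← dotProduct_smul, ← hv, Matrix.dotProduct_mulVec,
        ← Matrix.mulVec_transpose, ← Matrix.conjTranspose_eq_transpose_of_trivial, hP.eq, hv,
        smul_dotProduct, smul_eq_mul]
    rw [Matrix.one_apply_ne hkl]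
    by_contra hne
    exact hkl (hσ (mul_right_cancel₀ hne hsymm)).symm

theorem mul_mul_transpose_eq_diagonal_of_eigenvectors (hv : ∀ k, P *ᵥ v k = σ k • v k)
    (hV : Matrix.of v * (Matrix.of v)ᵀ = 1) :
    Matrix.of v * P * (Matrix.of v)ᵀ = Matrix.diagonal σ := by
  have hcols : P * (Matrix.of v)ᵀ = (Matrix.of v)ᵀ * Matrix.diagonal σ := by
    ext a k
    rw [Matrix.mul_diagonal, mul_comm]
    exact congrFun (hv k) a
  rw [mul_assoc, hcols, ← mul_assoc, hV, one_mul]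

theorem simMat_apply (v : Fin n → Fin n → ℝ) (i : Fin q) (a : Fin n) (k : Fin n) (j : Fin q) :
    simMat q v (i, a) (k, j) = if i = j then v k a else 0 := by
  simp [simMat, swapMat, Matrix.mul_apply, Matrix.one_apply]

theorem modalMatrix_eq_transpose_mul_mul (v : Fin n → Fin n → ℝ)
    (L : Matrix (Fin q × Fin n) (Fin q × Fin n) ℝ) :
    modalMatrix v L = (simMat q v)ᵀ * L * simMat q v := by
  ext ⟨k, i⟩ ⟨l, j⟩
  simp [modalMatrix, modalBlock, Matrix.mul_apply, simMat_apply, Fintype.sum_prod_type,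
    Matrix.one_apply, ite_mul, Finset.sum_ite_eq]

theorem simMat_transpose_mul_one_kronecker_mul (v : Fin n → Fin n → ℝ)
    (P : Matrix (Fin n) (Fin n) ℝ) :
    (simMat q v)ᵀ * ((1 : Matrix (Fin q) (Fin q) ℝ) ⊗ₖ P) * simMat q v =
      (Matrix.of v * P * (Matrix.of v)ᵀ) ⊗ₖ (1 : Matrix (Fin q) (Fin q) ℝ) := by
  have hkron : (1 : Matrix (Fin q) (Fin q) ℝ) ⊗ₖ (Matrix.of v * P * (Matrix.of v)ᵀ) =
      (1 ⊗ₖ Matrix.of v) * (1 ⊗ₖ P) * (1 ⊗ₖ (Matrix.of v)ᵀ) := by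
    rw [← Matrix.mul_kronecker_mul, ← Matrix.mul_kronecker_mul, one_mul, one_mul]
  rw [← swapMat_transpose_mul_kronecker_mul (q := q) (n := n), hkron, simMat, Matrix.transpose_mul,
    ← Matrix.kroneckerMap_transpose, Matrix.transpose_one, Matrix.transpose_transpose]
  simp only [Matrix.mul_assoc]

theorem simMat_transpose_mul_self (hV : Matrix.of v * (Matrix.of v)ᵀ = 1) :
    (simMat q v)ᵀ * simMat q v = 1 := by
  simpa [hV] using simMat_transpose_mul_one_kronecker_mul (q := q) v 1

theorem simMat_mul_transpose (hV : Matrix.of v * (Matrix.of v)ᵀ = 1) :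
    simMat q v * (simMat q v)ᵀ = 1 :=
  (Matrix.mul_eq_one_comm_of_card_eq _ _ _ (by simp [mul_comm])).1 (simMat_transpose_mul_self hV)

theorem toComplex_conj {ι κ : Type*} [Fintype ι] (S : Matrix ι κ ℝ) (X Y : Matrix ι ι ℝ) :
    toComplex (Sᵀ * X * S) (Sᵀ * Y * S) =
      Sᵀ.map Complex.ofReal * toComplex X Y * S.map Complex.ofReal := by
  simp only [toComplex, map_ofReal_mul, Matrix.mul_add, Matrix.add_mul, Matrix.mul_smul,
    Matrix.smul_mul]

theorem Omg_eq_conj_Gam (D R : Fin q → Fin q → Matrix (Fin n) (Fin n) ℝ) (ε : ℝ)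
    (hv : ∀ k, oscP M K *ᵥ v k = σ k • v k) (hV : Matrix.of v * (Matrix.of v)ᵀ = 1) :
    Omg M D R ε σ v = (simMat q v)ᵀ.map Complex.ofReal * Gam M K D R ε *
      (simMat q v).map Complex.ofReal := by
  rw [Gam, ← toComplex_conj, Omg, modalMatrix_eq_transpose_mul_mul,
    modalMatrix_eq_transpose_mul_mul, Matrix.mul_add, Matrix.add_mul,
    simMat_transpose_mul_one_kronecker_mul, mul_mul_transpose_eq_diagonal_of_eigenvectors hv hV,
    Matrix.mul_smul, Matrix.smul_mul]

theorem reLambda_conj {ι κ : Type*} [Fintype ι] [DecidableEq ι] [Fintype κ] [DecidableEq κ]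
    {S : Matrix ι κ ℝ} (hSS : S * Sᵀ = 1) (hcard : Fintype.card ι = Fintype.card κ) (k : ℕ)
    (X : Matrix ι ι ℂ) :
    reLambda k (Sᵀ.map Complex.ofReal * X * S.map Complex.ofReal) = reLambda k X := by
  have hS : S.map Complex.ofReal * Sᵀ.map Complex.ofReal = 1 := by
    rw [← map_ofReal_mul, hSS, Matrix.map_one _ Complex.ofReal_zero Complex.ofReal_one]
  have hchar := Matrix.charpoly_mul_comm' (Sᵀ.map Complex.ofReal * X) (S.map Complex.ofReal)
  rw [hcard, ← Matrix.mul_assoc, hS, Matrix.one_mul] at hchar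
  rw [reLambda, reLambda, mul_left_cancel₀ (pow_ne_zero _ Polynomial.X_ne_zero) hchar]

end Modal

end CoupledOsc

theorem mainTheorem7 {q n : ℕ} (hq : 2 ≤ q) (hn : 1 ≤ n)
    (M K : Matrix (Fin n) (Fin n) ℝ) (hM : M.PosDef) (hK : K.PosDef)
    (D R : Fin q → Fin q → Matrix (Fin n) (Fin n) ℝ) (hD : IsCoupling D) (hR : IsCoupling R)
    (σ : Fin n → ℝ) (hσ : ∀ s : ℝ, (s • M - K).det = 0 ↔ ∃ k, σ k = s)
    (hσ_inj : Function.Injective σ)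
    (v : Fin n → Fin n → ℝ) (hv_unit : ∀ k, v k ⬝ᵥ v k = 1)
    (hv : ∀ k, oscP M K *ᵥ v k = σ k • v k)
    (ε : ℝ) (hε : 0 ≤ ε) :
    (Synchronizes M K D R ε ↔ 0 < reLambda (n + 1) (Omg M D R ε σ v)) ∧
    (simMat q v)ᵀ * simMat q v = 1 ∧ simMat q v * (simMat q v)ᵀ = 1 ∧
    Omg M D R ε σ v = (simMat q v)ᵀ.map Complex.ofReal * Gam M K D R ε *
      (simMat q v).map Complex.ofReal := by
  have hV := mul_transpose_eq_one_of_eigenvectors (posDef_oscP hM hK).isHermitian hσ_inj hv_unit hv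
  have hΩ := Omg_eq_conj_Gam D R ε hv hV
  refine ⟨?_, simMat_transpose_mul_self hV, simMat_mul_transpose hV, hΩ⟩
  rw [hΩ, reLambda_conj (simMat_mul_transpose hV) (by simp [mul_comm])]
  exact synchronizes_iff_reLambda_Gam hq hn hM hK hD hR hε
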